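/- For $n\in\mathbb N=\{0,1,2,\ldots\}$ let $s(n)$ be the number of $1$s in the binary expansion of $n$, and for $t\in\mathbb N$ let \[c_t=\lim_{N\to\infty}\frac1N\bigl|\{0\le n<N: s(n+t)\ge s(n)\}\bigr|\] (the limit exists for every $t$). A block of $1$s in the binary expansion of $t$ is a nonempty contiguous sequence of digits $1$ of maximal size. For all $\varepsilon>0$ there exists an integer $L\ge 0$ such that the following holds: if the binary expansion of $t\in\mathbb N$ contains at least $L$ blocks of $1$s, then \[c_t>\tfrac12-\varepsilon.\] In particular, for all $\varepsilon>0$ there exist real numbers $\delta>0$ and $C>0$ such that for all real $T\ge2$, \[\bigl|\{t\in\mathbb N: 0\le t<T,\ c_t\le \tfrac12-\varepsilon\}\bigr|\le C(\log T)^{\delta}.\] -/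

import Mathlib

open Filter Topology

/-- The binary sum-of-digits function: the number of `1`s in the base-2 expansion of `n`. -/
def binaryDigitSum (n : ℕ) : ℕ := (Nat.digits 2 n).sum

/-- The set `A` of natural numbers has an asymptotic density, and it equals `d`:
`(1 / N) * #{0 ≤ n < N : n ∈ A}` tends to `d` as `N → ∞`. -/
def HasAsymptoticDensity (A : Set ℕ) (d : ℝ) : Prop :=
  Tendsto (fun N : ℕ => (1 / (N : ℝ)) * (({n : ℕ | n < N ∧ n ∈ A}.ncard : ℕ) : ℝ)) atTop (𝓝 d)

/-- The asymptotic density of `A`, as a limit (an arbitrary value if the limit does not exist). -/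
noncomputable def asymptoticDensity (A : Set ℕ) : ℝ :=
  limUnder atTop (fun N : ℕ => (1 / (N : ℝ)) * (({n : ℕ | n < N ∧ n ∈ A}.ncard : ℕ) : ℝ))

/-- The set of all `n` with `s (n + t) ≥ s n`, where `s` is the binary sum of digits. -/
def cusickSet (t : ℕ) : Set ℕ := {n : ℕ | binaryDigitSum (n + t) ≥ binaryDigitSum n}

/-- The value `c_t`: the asymptotic density of the `n` with `s (n + t) ≥ s n`. -/
noncomputable def cusickDensity (t : ℕ) : ℝ := asymptoticDensity (cusickSet t)

/-- The digit positions `i, i + 1, …, j - 1` (position `0` is the least significant one) form a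
block of `1`s of `t`: a nonempty contiguous sequence of digits `1` of maximal size, that is,
it cannot be prolonged at either end. -/
def IsBlockOfOnes (t i j : ℕ) : Prop :=
  i < j ∧ (∀ k, i ≤ k → k < j → t.testBit k = true) ∧
    t.testBit j = false ∧ (∀ k, k + 1 = i → t.testBit k = false)

/-- The number of blocks of `1`s in the binary expansion of `t`. -/
noncomputable def numBlocksOfOnes (t : ℕ) : ℕ := {p : ℕ × ℕ | IsBlockOfOnes t p.1 p.2}.ncard

/-- There are only finitely many blocks, so that the cardinality above is the true one. -/
theorem finite_blocksOfOnes (t : ℕ) : {p : ℕ × ℕ | IsBlockOfOnes t p.1 p.2}.Finite := by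
  refine (Set.finite_Iic ((t, t) : ℕ × ℕ)).subset ?_
  rintro ⟨i, j⟩ ⟨hij, h, -, -⟩
  have h1 := Nat.ge_two_pow_of_testBit (h (j - 1) (Nat.le_sub_one_of_lt hij) (by
    have : i < j := hij
    omega))
  have h2 : j - 1 < 2 ^ (j - 1) := Nat.lt_two_pow_self
  have h3 : i < j := hij
  refine ⟨?_, ?_⟩ <;> simp only <;> omega

/-! Write d(t, n) = s(n + t) - s(n). Splitting n by parity shows that, for random n, d(2t, ·) is
distributed like d(t, ·), while d(2t + 1, ·) is an equal mixture of d(t, ·) + 1 and d(t + 1, ·) - 1.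
All means vanish, so the variances satisfy v(2t) = v(t) and v(2t + 1) = 1 + (v(t) + v(t + 1)) / 2.

The characteristic function is Gaussian up to |θ|³ v(t): one mixing step costs at most |θ|³, because
|v(t + 1) - v(t)| ≤ 2, and the accumulated error then obeys the same recursion as v
(`norm_diffCharFun_sub_exp_le`). At θ / √v(t) the error is |θ|³ / √v(t), so the normalized
differences tend to a standard normal law whenever v(t) → ∞.

The variance is at least linear in the number of blocks (`numBlocksOfOnes_le_two_mul_diffVariance`).
A sequence of counterexamples with ever more blocks would thus have a normal limit, which gives (0,
∞) mass 1/2: a contradiction. The second claim follows since few integers below T have a bounded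
number of blocks. -/

/-! ### Recurrences for the digit-sum difference -/

/-- The change of the binary digit sum of `n` under addition of `t`. -/
def digitSumDiff (t n : ℕ) : ℤ := (binaryDigitSum (n + t) : ℤ) - binaryDigitSum n

theorem binaryDigitSum_two_mul (n : ℕ) : binaryDigitSum (2 * n) = binaryDigitSum n := by
  rcases Nat.eq_zero_or_pos n with rfl | hn
  · rfl
  · unfold binaryDigitSum
    rw [Nat.digits_def' (by norm_num) (by omega)]
    simp

theorem binaryDigitSum_two_mul_add_one (n : ℕ) :
    binaryDigitSum (2 * n + 1) = binaryDigitSum n + 1 := by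
  unfold binaryDigitSum
  rw [Nat.digits_def' (by norm_num) (by omega)]
  have h1 : (2 * n + 1) % 2 = 1 := by omega
  have h2 : (2 * n + 1) / 2 = n := by omega
  rw [h1, h2, List.sum_cons, add_comm]

@[simp] theorem digitSumDiff_zero_left (n : ℕ) : digitSumDiff 0 n = 0 := by simp [digitSumDiff]

theorem digitSumDiff_even_even (t n : ℕ) : digitSumDiff (2 * t) (2 * n) = digitSumDiff t n := by
  simp [digitSumDiff, ← mul_add, binaryDigitSum_two_mul]

theorem digitSumDiff_even_odd (t n : ℕ) :
    digitSumDiff (2 * t) (2 * n + 1) = digitSumDiff t n := by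
  rw [digitSumDiff, show 2 * n + 1 + 2 * t = 2 * (n + t) + 1 by ring]
  simp [digitSumDiff, binaryDigitSum_two_mul_add_one]

theorem digitSumDiff_odd_even (t n : ℕ) :
    digitSumDiff (2 * t + 1) (2 * n) = digitSumDiff t n + 1 := by
  rw [digitSumDiff, show 2 * n + (2 * t + 1) = 2 * (n + t) + 1 by ring]
  simp [digitSumDiff, binaryDigitSum_two_mul_add_one, binaryDigitSum_two_mul]
  ring

theorem digitSumDiff_odd_odd (t n : ℕ) :
    digitSumDiff (2 * t + 1) (2 * n + 1) = digitSumDiff (t + 1) n - 1 := by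
  rw [digitSumDiff, show 2 * n + 1 + (2 * t + 1) = 2 * (n + (t + 1)) by ring]
  simp [digitSumDiff, binaryDigitSum_two_mul_add_one, binaryDigitSum_two_mul]
  ring

theorem digitSumDiff_one_le (n : ℕ) : digitSumDiff 1 n ≤ 1 := by
  induction n using Nat.strong_induction_on with
  | _ n ih =>
    obtain ⟨k, rfl | rfl⟩ := Nat.even_or_odd' n
    · simpa using (digitSumDiff_odd_even 0 k).le
    · have h := digitSumDiff_odd_odd 0 k
      have := ih k (by omega)
      simp only [mul_zero, zero_add] at h
      omega

/-! ### The variance recursion -/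

/-- The variance of the asymptotic distribution of `digitSumDiff t`. -/
noncomputable def diffVariance : ℕ → ℝ
  | 0 => 0
  -- The odd rule at 0 refers back to 1; its fixed point x = 1 + (0 + x) / 2 is 2.
  | 1 => 2
  | n + 2 => if n % 2 = 0 then diffVariance (n / 2 + 1)
      else 1 + (diffVariance (n / 2 + 1) + diffVariance (n / 2 + 2)) / 2

theorem diffVariance_zero : diffVariance 0 = 0 := by rw [diffVariance]

theorem diffVariance_one : diffVariance 1 = 2 := by rw [diffVariance]

theorem diffVariance_two_mul (t : ℕ) : diffVariance (2 * t) = diffVariance t := by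
  rcases t with _ | t
  · rfl
  · rw [show 2 * (t + 1) = 2 * t + 2 by ring, diffVariance]
    simp

theorem diffVariance_two_mul_add_one (t : ℕ) :
    diffVariance (2 * t + 1) = 1 + (diffVariance t + diffVariance (t + 1)) / 2 := by
  rcases t with _ | t
  · norm_num [diffVariance_zero, diffVariance_one]
  · rw [show 2 * (t + 1) + 1 = (2 * t + 1) + 2 by ring, diffVariance]
    have h1 : (2 * t + 1) % 2 = 1 := by omega
    have h2 : (2 * t + 1) / 2 = t := by omega
    simp [h1, h2, add_assoc]

/-- Each gap is ±1 plus half of an earlier gap, so the bound 2 reproduces itself. -/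
theorem abs_diffVariance_succ_sub_le (t : ℕ) : |diffVariance (t + 1) - diffVariance t| ≤ 2 := by
  induction t using Nat.strong_induction_on with
  | _ t ih =>
    obtain ⟨k, rfl | rfl⟩ := Nat.even_or_odd' t
    · rcases Nat.eq_zero_or_pos k with rfl | hk
      · norm_num [diffVariance_zero, diffVariance_one]
      · have := abs_le.1 (ih k (by omega))
        rw [diffVariance_two_mul_add_one, diffVariance_two_mul, abs_le]
        constructor <;> linarith
    · have := abs_le.1 (ih k (by omega))
      rw [show 2 * k + 1 + 1 = 2 * (k + 1) by ring, diffVariance_two_mul_add_one,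
        diffVariance_two_mul, abs_le]
      constructor <;> linarith

theorem diffVariance_nonneg (t : ℕ) : 0 ≤ diffVariance t := by
  induction t using Nat.strong_induction_on with
  | _ t ih =>
    obtain ⟨k, rfl | rfl⟩ := Nat.even_or_odd' t
    · rcases Nat.eq_zero_or_pos k with rfl | hk
      · simp [diffVariance_zero]
      · rw [diffVariance_two_mul]
        exact ih k (by omega)
    · rcases Nat.eq_zero_or_pos k with rfl | hk
      · simp [diffVariance_one]
      · rw [diffVariance_two_mul_add_one]
        have := ih k (by omega)
        have := ih (k + 1) (by omega)
        positivity

/-! ### Existence of the densities -/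

theorem hasAsymptoticDensity_congr {A B : Set ℕ} {d : ℝ} (h : ∀ n, n ∈ A ↔ n ∈ B)
    (hA : HasAsymptoticDensity A d) : HasAsymptoticDensity B d := by
  rwa [← Set.ext h]

theorem hasAsymptoticDensity_empty : HasAsymptoticDensity ∅ 0 := by
  simp [HasAsymptoticDensity]

theorem hasAsymptoticDensity_univ : HasAsymptoticDensity Set.univ 1 := by
  have h (N : ℕ) : {n : ℕ | n < N ∧ n ∈ Set.univ}.ncard = N := by
    rw [show {n : ℕ | n < N ∧ n ∈ Set.univ} = (Finset.range N : Set ℕ) by ext; simp,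
      Set.ncard_coe_finset, Finset.card_range]
  simp only [HasAsymptoticDensity, h]
  refine tendsto_const_nhds.congr' ?_
  filter_upwards [eventually_gt_atTop 0] with N hN
  have : (N : ℝ) ≠ 0 := by positivity
  field_simp

theorem ncard_lt_two_mul (A : Set ℕ) (N : ℕ) :
    {n | n < 2 * N ∧ n ∈ A}.ncard =
      {n | n < N ∧ 2 * n ∈ A}.ncard + {n | n < N ∧ 2 * n + 1 ∈ A}.ncard := by
  have fin (P : ℕ → Prop) (f : ℕ → ℕ) : (f '' {n | n < N ∧ P n}).Finite :=
    ((Set.finite_Iio N).subset fun n hn => hn.1).image f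
  rw [show {n | n < 2 * N ∧ n ∈ A} = (fun n => 2 * n) '' {n | n < N ∧ 2 * n ∈ A} ∪
      (fun n => 2 * n + 1) '' {n | n < N ∧ 2 * n + 1 ∈ A} from ?_,
    Set.ncard_union_eq ?_ (fin _ _) (fin _ _),
    Set.ncard_image_of_injective _ fun a b h => by simpa using h,
    Set.ncard_image_of_injective _ fun a b h => by simpa using h]
  · rw [Set.disjoint_left]
    rintro _ ⟨a, -, rfl⟩ ⟨b, -, h⟩
    simp only at h
    omega
  · ext n
    simp only [Set.mem_ofPred_eq, Set.mem_union, Set.mem_image]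
    constructor
    · rintro ⟨h1, h2⟩
      obtain ⟨k, rfl | rfl⟩ := Nat.even_or_odd' n
      · exact Or.inl ⟨k, ⟨by omega, h2⟩, rfl⟩
      · exact Or.inr ⟨k, ⟨by omega, h2⟩, rfl⟩
    · rintro (⟨k, ⟨h1, h2⟩, rfl⟩ | ⟨k, ⟨h1, h2⟩, rfl⟩)
      · exact ⟨by omega, h2⟩
      · exact ⟨by omega, h2⟩

theorem ncard_lt_le_succ (A : Set ℕ) (N : ℕ) :
    {n | n < N ∧ n ∈ A}.ncard ≤ {n | n < N + 1 ∧ n ∈ A}.ncard ∧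
      {n | n < N + 1 ∧ n ∈ A}.ncard ≤ {n | n < N ∧ n ∈ A}.ncard + 1 := by
  constructor
  · exact Set.ncard_le_ncard (fun n hn => ⟨hn.1.trans N.lt_succ_self, hn.2⟩)
      ((Set.finite_Iio (N + 1)).subset fun n hn => hn.1)
  · refine (Set.ncard_le_ncard (t := insert N {n | n < N ∧ n ∈ A}) ?_ ?_).trans
      (Set.ncard_insert_le _ _)
    · rintro n ⟨h1, h2⟩
      rcases Nat.lt_succ_iff_lt_or_eq.1 h1 with h | h
      · exact Or.inr ⟨h, h2⟩
      · exact Or.inl h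
    · exact ((Set.finite_Iio N).subset fun n hn => hn.1).insert _

/-- A set whose even and odd parts have densities `a` and `b` has density `(a + b) / 2`. -/
theorem HasAsymptoticDensity.of_even_odd {A : Set ℕ} {a b : ℝ}
    (ha : HasAsymptoticDensity {n | 2 * n ∈ A} a)
    (hb : HasAsymptoticDensity {n | 2 * n + 1 ∈ A} b) :
    HasAsymptoticDensity A ((a + b) / 2) := by
  set c : ℕ → ℝ := fun N => ({n : ℕ | n < N ∧ n ∈ A}.ncard : ℝ) with hc
  have hhalf : Tendsto (fun N : ℕ => N / 2) atTop atTop :=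
    tendsto_atTop.2 fun b => (eventually_ge_atTop (2 * b)).mono fun N hN => by omega
  have hs := ((ha.add hb).div_const 2).comp hhalf
  have herr : Tendsto (fun N : ℕ => 3 / (N : ℝ)) atTop (𝓝 0) :=
    tendsto_const_nhds.div_atTop tendsto_natCast_atTop_atTop
  -- Counts up to an even bound split exactly by parity; an odd N adds at most one element and
  -- perturbs the normalization, an O(1 / N) effect.
  have hclose : ∀ᶠ N : ℕ in atTop, ‖1 / (N : ℝ) * c N - c (2 * (N / 2)) / (2 * (N / 2 : ℕ))‖
      ≤ 3 / (N : ℝ) := by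
    filter_upwards [eventually_ge_atTop 2] with N hN
    have hcle (M : ℕ) : c M ≤ M := by
      have h := Set.ncard_le_ncard (s := {n | n < M ∧ n ∈ A}) (t := Set.Iio M)
        (fun n hn => hn.1) (Set.finite_Iio M)
      rw [← Finset.coe_Iio, Set.ncard_coe_finset, Nat.card_Iio] at h
      exact Nat.cast_le.2 h
    have h0 (M : ℕ) : 0 ≤ c M := Nat.cast_nonneg _
    have hN2 : 1 ≤ N / 2 := by omega
    rcases Nat.even_or_odd' N with ⟨k, rfl | rfl⟩
    · have : 2 * k / 2 = k := by omega
      rw [this]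
      push_cast
      rw [one_div, inv_mul_eq_div, sub_self, norm_zero]
      positivity
    · have hk : (2 * k + 1) / 2 = k := by omega
      rw [hk] at hN2 ⊢
      have hk0 : (1 : ℝ) ≤ k := by exact_mod_cast hN2
      have h1 : c (2 * k) ≤ c (2 * k + 1) := by
        exact Nat.cast_le.2 (ncard_lt_le_succ A (2 * k)).1
      have h2 : c (2 * k + 1) ≤ c (2 * k) + 1 := by
        have := (ncard_lt_le_succ A (2 * k)).2
        simp only [hc]
        exact_mod_cast this
      have h3 := hcle (2 * k)
      have h4 := h0 (2 * k)
      push_cast at h3 ⊢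
      rw [Real.norm_eq_abs, show 1 / (2 * (k : ℝ) + 1) * c (2 * k + 1) - c (2 * k) / (2 * k) =
        ((c (2 * k + 1) - c (2 * k)) - c (2 * k) / (2 * k)) / (2 * k + 1) by field_simp; ring,
        abs_div, abs_of_pos (show (0 : ℝ) < 2 * k + 1 by positivity)]
      gcongr
      have h5 : c (2 * k) / (2 * k) ≤ 1 := by rw [div_le_one (by positivity)]; exact h3
      have h6 : 0 ≤ c (2 * k) / (2 * k) := by positivity
      rw [abs_le]
      constructor <;> linarith
  have hz := squeeze_zero_norm' hclose herr
  have hsum := hz.add hs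
  rw [zero_add] at hsum
  refine hsum.congr fun N => ?_
  simp only [Function.comp_apply, Set.mem_ofPred_eq]
  have : c (2 * (N / 2)) = ({n | n < N / 2 ∧ 2 * n ∈ A}.ncard : ℝ) +
      ({n | n < N / 2 ∧ 2 * n + 1 ∈ A}.ncard : ℝ) := by
    simp only [hc]
    exact_mod_cast ncard_lt_two_mul A (N / 2)
  rw [this]
  ring

theorem exists_hasAsymptoticDensity_diff_ge (t : ℕ) :
    ∀ a : ℤ, ∃ d, HasAsymptoticDensity {n | a ≤ digitSumDiff t n} d := by
  have zero (a : ℤ) : ∃ d, HasAsymptoticDensity {n | a ≤ digitSumDiff 0 n} d := by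
    by_cases ha : a ≤ 0
    · exact ⟨1, hasAsymptoticDensity_congr (by simp [ha]) hasAsymptoticDensity_univ⟩
    · exact ⟨0, hasAsymptoticDensity_congr (by simpa using ha) hasAsymptoticDensity_empty⟩
  have odd {t : ℕ} {a : ℤ} (h1 : ∃ d, HasAsymptoticDensity {n | a - 1 ≤ digitSumDiff t n} d)
      (h2 : ∃ d, HasAsymptoticDensity {n | a + 1 ≤ digitSumDiff (t + 1) n} d) :
      ∃ d, HasAsymptoticDensity {n | a ≤ digitSumDiff (2 * t + 1) n} d := by
    obtain ⟨d, hd⟩ := h1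
    obtain ⟨e, he⟩ := h2
    refine ⟨_, HasAsymptoticDensity.of_even_odd (hasAsymptoticDensity_congr (fun n => ?_) hd)
      (hasAsymptoticDensity_congr (fun n => ?_) he)⟩
    · simp only [Set.mem_ofPred_eq, digitSumDiff_odd_even]
      omega
    · simp only [Set.mem_ofPred_eq, digitSumDiff_odd_odd]
      omega
  -- The odd rule for t = 1 returns to t = 1, with a replaced by a + 1. The induction therefore runs
  -- downwards in a, from the empty sets with a ≥ 2.
  have one (k : ℕ) : ∀ a : ℤ, 2 - k ≤ a →
      ∃ d, HasAsymptoticDensity {n | a ≤ digitSumDiff 1 n} d := by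
    induction k with
    | zero =>
      intro a ha
      refine ⟨0, hasAsymptoticDensity_congr (fun n => ?_) hasAsymptoticDensity_empty⟩
      have := digitSumDiff_one_le n
      simp only [Set.mem_empty_iff_false, Set.mem_ofPred_eq, false_iff]
      push_cast at ha
      omega
    | succ k ih =>
      intro a ha
      push_cast at ha
      exact odd (t := 0) (zero _) (ih (a + 1) (by omega))
  induction t using Nat.strong_induction_on with
  | _ t ih =>
    intro a
    obtain ⟨k, rfl | rfl⟩ := Nat.even_or_odd' t
    · rcases Nat.eq_zero_or_pos k with rfl | hk
      · exact zero a
      · obtain ⟨d, hd⟩ := ih k (by omega) a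
        refine ⟨_, HasAsymptoticDensity.of_even_odd (hasAsymptoticDensity_congr (fun n => ?_) hd)
          (hasAsymptoticDensity_congr (fun n => ?_) hd)⟩
        · simp only [Set.mem_ofPred_eq, digitSumDiff_even_even]
        · simp only [Set.mem_ofPred_eq, digitSumDiff_even_odd]
    · rcases Nat.eq_zero_or_pos k with rfl | hk
      · exact one (2 - a).toNat a (by omega)
      · exact odd (ih k (by omega) _) (ih (k + 1) (by omega) _)

theorem mem_cusickSet_iff (t n : ℕ) : n ∈ cusickSet t ↔ 0 ≤ digitSumDiff t n := by
  simp [cusickSet, digitSumDiff]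

theorem hasAsymptoticDensity_cusickSet (t : ℕ) :
    HasAsymptoticDensity (cusickSet t) (cusickDensity t) := by
  obtain ⟨d, hd⟩ := exists_hasAsymptoticDensity_diff_ge t 0
  have h : HasAsymptoticDensity (cusickSet t) d :=
    hasAsymptoticDensity_congr (fun n => (mem_cusickSet_iff t n).symm) hd
  rwa [show cusickDensity t = d from Tendsto.limUnder_eq h]

/-! ### One step of the Gaussian approximation -/

/-- With z the argument of cosh, both functions agree with 1 - θ² / 2 to second order. The cubic
error comes from the cross term of z²; the remaining errors are quartic. -/
theorem norm_cosh_sub_exp_le {θ d : ℝ} (hθ : |θ| ≤ 1 / 2) (hd : |d| ≤ 2) :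
    ‖Complex.cosh (θ * Complex.I + d * θ ^ 2 / 4) - Complex.exp (-(θ : ℂ) ^ 2 / 2)‖
      ≤ |θ| ^ 3 := by
  set z : ℂ := θ * Complex.I + d * θ ^ 2 / 4 with hz
  set x : ℝ := |θ| with hx
  have hx0 : 0 ≤ x := abs_nonneg θ
  have hθn : ‖(θ : ℂ)‖ = x := by simp [hx]
  have hdn : ‖(d : ℂ)‖ ≤ 2 := by simpa using hd
  have hzn : ‖z‖ ≤ 5 / 4 * x := by
    calc ‖z‖ ≤ ‖(θ : ℂ) * Complex.I‖ + ‖(d : ℂ) * θ ^ 2 / 4‖ := norm_add_le _ _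
      _ = x + ‖(d : ℂ)‖ * x ^ 2 / 4 := by
        simp only [norm_mul, norm_div, norm_pow, hθn, Complex.norm_I]; norm_num
      _ ≤ x + 2 * x ^ 2 / 4 := by gcongr
      _ ≤ 5 / 4 * x := by nlinarith
  have h1 : ‖Complex.cosh z - (1 + z ^ 2 / 2)‖ ≤ x ^ 3 * (1 / 8) := by
    have hz1 : ‖z * Complex.I‖ ≤ 1 := by
      rw [norm_mul, Complex.norm_I]; linarith
    have h := Complex.cos_bound hz1
    rw [Complex.cos_mul_I, mul_pow, Complex.I_sq, norm_mul, Complex.norm_I, mul_one] at h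
    calc _ = ‖Complex.cosh z - (1 - z ^ 2 * -1 / 2)‖ := by congr 1; ring
      _ ≤ ‖z‖ ^ 4 * (5 / 96) := h
      _ ≤ (5 / 4 * x) ^ 4 * (5 / 96) := by gcongr
      _ = x ^ 3 * (x * (625 * 5 / (256 * 96))) := by ring
      _ ≤ x ^ 3 * (1 / 8) := by gcongr; linarith
  have h2 : ‖z ^ 2 / 2 + (θ : ℂ) ^ 2 / 2‖ ≤ x ^ 3 * (5 / 8) := by
    have : z ^ 2 / 2 + (θ : ℂ) ^ 2 / 2 = θ ^ 3 * d / 4 * Complex.I + d ^ 2 * θ ^ 4 / 32 := by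
      rw [hz]
      linear_combination (θ : ℂ) ^ 2 / 2 * Complex.I_sq
    rw [this]
    calc _ ≤ ‖(θ : ℂ) ^ 3 * d / 4 * Complex.I‖ + ‖(d : ℂ) ^ 2 * θ ^ 4 / 32‖ := norm_add_le _ _
      _ = x ^ 3 * ‖(d : ℂ)‖ / 4 + ‖(d : ℂ)‖ ^ 2 * x ^ 4 / 32 := by
        simp only [norm_mul, norm_div, norm_pow, hθn, Complex.norm_I]; norm_num
      _ ≤ x ^ 3 * 2 / 4 + 2 ^ 2 * x ^ 4 / 32 := by gcongr
      _ = x ^ 3 * (1 / 2 + x / 8) := by ring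
      _ ≤ x ^ 3 * (5 / 8) := by gcongr; linarith
  have h3 : ‖Complex.exp (-(θ : ℂ) ^ 2 / 2) - 1 - (-(θ : ℂ) ^ 2 / 2)‖ ≤ x ^ 3 * (1 / 8) := by
    have hn : ‖-(θ : ℂ) ^ 2 / 2‖ = x ^ 2 / 2 := by
      rw [norm_div, norm_neg, norm_pow, hθn]; norm_num
    refine (Complex.norm_exp_sub_one_sub_id_le (by rw [hn]; nlinarith)).trans ?_
    rw [hn]
    calc (x ^ 2 / 2) ^ 2 = x ^ 3 * (x * (1 / 4)) := by ring
      _ ≤ x ^ 3 * (1 / 8) := mul_le_mul_of_nonneg_left (by linarith) (by positivity)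
  calc _ = ‖(Complex.cosh z - (1 + z ^ 2 / 2)) + (z ^ 2 / 2 + (θ : ℂ) ^ 2 / 2) -
        (Complex.exp (-(θ : ℂ) ^ 2 / 2) - 1 - (-(θ : ℂ) ^ 2 / 2))‖ := by congr 1; ring
    _ ≤ _ := (norm_sub_le _ _).trans (add_le_add_left (norm_add_le _ _) _)
    _ ≤ x ^ 3 := by have : 0 ≤ x ^ 3 := by positivity
                    linarith

/-- Pulling out the common factor exp(-(a + b)θ² / 4), of norm at most 1, turns the average into a
hyperbolic cosine. -/
theorem norm_average_exp_sub_exp_le {θ a b : ℝ} (hθ : |θ| ≤ 1 / 2) (ha : 0 ≤ a) (hb : 0 ≤ b)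
    (hab : |b - a| ≤ 2) :
    ‖(Complex.exp (θ * Complex.I) * Complex.exp (-a * θ ^ 2 / 2) +
        Complex.exp (-θ * Complex.I) * Complex.exp (-b * θ ^ 2 / 2)) / 2 -
      Complex.exp (-(1 + (a + b) / 2) * θ ^ 2 / 2)‖ ≤ |θ| ^ 3 := by
  have key : (Complex.exp (θ * Complex.I) * Complex.exp (-a * θ ^ 2 / 2) +
        Complex.exp (-θ * Complex.I) * Complex.exp (-b * θ ^ 2 / 2)) / 2 -
      Complex.exp (-(1 + (a + b) / 2) * θ ^ 2 / 2) =
      Complex.exp ((-((a + b) / 2) * θ ^ 2 / 2 : ℝ)) *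
        (Complex.cosh (θ * Complex.I + (b - a : ℝ) * θ ^ 2 / 4) -
          Complex.exp (-(θ : ℂ) ^ 2 / 2)) := by
    rw [Complex.cosh, mul_sub, ← Complex.exp_add, mul_div_assoc', mul_add]
    simp only [← Complex.exp_add]
    push_cast
    congr 1
    · congr 2
      · congr 1; ring
      · congr 1; ring
    · congr 1; ring
  rw [key, norm_mul, Complex.norm_exp_ofReal]
  have h1 : Real.exp (-((a + b) / 2) * θ ^ 2 / 2) ≤ 1 := by
    rw [Real.exp_le_one_iff]
    have : 0 ≤ (a + b) / 2 * θ ^ 2 := by positivity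
    linarith
  exact (mul_le_of_le_one_left (norm_nonneg _) h1).trans (norm_cosh_sub_exp_le hθ hab)

/-! ### Characteristic functions -/

/-- The characteristic function of `digitSumDiff t` on the uniform distribution on
`{0, …, 2 ^ M - 1}`. -/
noncomputable def diffCharFun (M t : ℕ) (θ : ℝ) : ℂ :=
  (∑ n ∈ Finset.range (2 ^ M), Complex.exp (θ * digitSumDiff t n * Complex.I)) / 2 ^ M

theorem sum_range_two_mul_eq {β : Type*} [AddCommMonoid β] (f : ℕ → β) (N : ℕ) :
    ∑ n ∈ Finset.range (2 * N), f n =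
      ∑ n ∈ Finset.range N, f (2 * n) + ∑ n ∈ Finset.range N, f (2 * n + 1) := by
  induction N with
  | zero => simp
  | succ N ih =>
    rw [show 2 * (N + 1) = 2 * N + 1 + 1 by ring, Finset.sum_range_succ, Finset.sum_range_succ, ih,
      Finset.sum_range_succ, Finset.sum_range_succ]
    abel

theorem diffCharFun_succ_two_mul (M t : ℕ) (θ : ℝ) :
    diffCharFun (M + 1) (2 * t) θ = diffCharFun M t θ := by
  rw [diffCharFun, pow_succ', sum_range_two_mul_eq]
  simp only [digitSumDiff_even_even, digitSumDiff_even_odd, diffCharFun]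
  rw [pow_succ', ← two_mul, mul_div_mul_left _ _ two_ne_zero]

theorem diffCharFun_succ_two_mul_add_one (M t : ℕ) (θ : ℝ) :
    diffCharFun (M + 1) (2 * t + 1) θ = (Complex.exp (θ * Complex.I) * diffCharFun M t θ +
      Complex.exp (-θ * Complex.I) * diffCharFun M (t + 1) θ) / 2 := by
  rw [diffCharFun, pow_succ', sum_range_two_mul_eq]
  simp only [digitSumDiff_odd_even, digitSumDiff_odd_odd, diffCharFun]
  rw [pow_succ', mul_div_assoc', mul_div_assoc', Finset.mul_sum, Finset.mul_sum, ← add_div,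
    div_div, mul_comm]
  congr 2
  · refine Finset.sum_congr rfl fun n _ => ?_
    rw [← Complex.exp_add]
    push_cast
    congr 1; ring
  · refine Finset.sum_congr rfl fun n _ => ?_
    rw [← Complex.exp_add]
    push_cast
    congr 1; ring

/-- Both error terms are propagated exactly: the new |θ|³ at an odd step is the 1 in the variance
recursion, and averaging 2k and 2(k + 1) gives 2k + 1. The term 2t / 2 ^ M absorbs the trivial bound
2 at M = 0, where t = 0 is exact. -/
theorem norm_diffCharFun_sub_exp_le {θ : ℝ} (hθ : |θ| ≤ 1 / 2) (M : ℕ) : ∀ t : ℕ,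
    ‖diffCharFun M t θ - Complex.exp (-(diffVariance t) * θ ^ 2 / 2)‖ ≤
      |θ| ^ 3 * diffVariance t + 2 * t / 2 ^ M := by
  induction M with
  | zero =>
    intro t
    rcases Nat.eq_zero_or_pos t with rfl | ht
    · simp [diffCharFun, diffVariance_zero]
    · have h1 : ‖diffCharFun 0 t θ‖ = 1 := by
        simp only [diffCharFun, pow_zero, Finset.sum_range_one, div_one]
        have := Complex.norm_exp_ofReal_mul_I (θ * digitSumDiff t 0)
        push_cast at this
        exact this
      have h2 : ‖Complex.exp (-(diffVariance t) * θ ^ 2 / 2)‖ ≤ 1 := by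
        have : (-(diffVariance t) * θ ^ 2 / 2 : ℂ) = ((-(diffVariance t) * θ ^ 2 / 2 : ℝ) : ℂ) := by
          push_cast; rfl
        rw [this, Complex.norm_exp_ofReal, Real.exp_le_one_iff]
        have := mul_nonneg (diffVariance_nonneg t) (sq_nonneg θ)
        linarith
      have h3 : (1 : ℝ) ≤ t := by exact_mod_cast ht
      have h4 : 0 ≤ |θ| ^ 3 * diffVariance t :=
        mul_nonneg (by positivity) (diffVariance_nonneg t)
      refine (norm_sub_le _ _).trans ?_
      rw [pow_zero, div_one]
      linarith
  | succ M ih =>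
    intro t
    obtain ⟨k, rfl | rfl⟩ := Nat.even_or_odd' t
    · rw [diffCharFun_succ_two_mul, diffVariance_two_mul]
      refine (ih k).trans (le_of_eq ?_)
      push_cast
      rw [pow_succ' _ M, mul_div_mul_left _ _ (two_ne_zero' ℝ)]
    · rw [diffCharFun_succ_two_mul_add_one, diffVariance_two_mul_add_one]
      have hstep := norm_average_exp_sub_exp_le hθ (diffVariance_nonneg k)
        (diffVariance_nonneg (k + 1)) (abs_diffVariance_succ_sub_le k)
      have e1 : ‖Complex.exp (θ * Complex.I)‖ = 1 := Complex.norm_exp_ofReal_mul_I θ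
      have e2 : ‖Complex.exp (-θ * Complex.I)‖ = 1 := by
        have := Complex.norm_exp_ofReal_mul_I (-θ)
        push_cast at this
        exact this
      set G := diffCharFun M k θ
      set G' := diffCharFun M (k + 1) θ
      set E := Complex.exp (-(diffVariance k) * θ ^ 2 / 2)
      set E' := Complex.exp (-(diffVariance (k + 1)) * θ ^ 2 / 2)
      set u := Complex.exp (θ * Complex.I)
      set w := Complex.exp (-θ * Complex.I)
      push_cast
      set F := Complex.exp (-(1 + ((diffVariance k : ℂ) + diffVariance (k + 1)) / 2) * θ ^ 2 / 2)
      have hk := ih k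
      have hk' := ih (k + 1)
      calc ‖(u * G + w * G') / 2 - F‖
          = ‖u * (G - E) / 2 + w * (G' - E') / 2 + ((u * E + w * E') / 2 - F)‖ := by
            congr 1; ring
        _ ≤ ‖u * (G - E) / 2‖ + ‖w * (G' - E') / 2‖ + ‖(u * E + w * E') / 2 - F‖ :=
            norm_add₃_le
        _ = ‖G - E‖ / 2 + ‖G' - E'‖ / 2 + ‖(u * E + w * E') / 2 - F‖ := by
            simp only [norm_div, norm_mul, e1, e2, one_mul, Complex.norm_ofNat]
        _ ≤ (|θ| ^ 3 * diffVariance k + 2 * k / 2 ^ M) / 2 +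
            (|θ| ^ 3 * diffVariance (k + 1) + 2 * (k + 1 : ℕ) / 2 ^ M) / 2 + |θ| ^ 3 := by
            gcongr
        _ = _ := by
            push_cast
            rw [pow_succ]
            field_simp
            ring

/-! ### Blocks of ones and the variance -/

theorem isBlockOfOnes_two_mul {t i j : ℕ} (h : IsBlockOfOnes (2 * t) i j) :
    ∃ i' j', i = i' + 1 ∧ j = j' + 1 ∧ IsBlockOfOnes t i' j' := by
  obtain ⟨hij, h1, h2, h3⟩ := h
  have hbit (k : ℕ) : (2 * t).testBit (k + 1) = t.testBit k := by
    rw [Nat.testBit_add_one, Nat.mul_div_cancel_left _ two_pos]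
  obtain ⟨j, rfl⟩ : ∃ j', j = j' + 1 := ⟨j - 1, by omega⟩
  rcases i with _ | i
  · have := h1 0 le_rfl hij
    simp at this
  · refine ⟨i, j, rfl, rfl, by omega, fun k hk hk' => ?_, ?_, fun k hk => ?_⟩
    · rw [← hbit]; exact h1 _ (by omega) (by omega)
    · rw [← hbit]; exact h2
    · rw [← hbit]; exact h3 _ (by omega)

theorem isBlockOfOnes_two_mul_add_one {t i j : ℕ} (h : IsBlockOfOnes (2 * t + 1) i j) :
    (i = 0 ∧ (∀ k < j, (2 * t + 1).testBit k = true) ∧ (2 * t + 1).testBit j = false) ∨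
    ∃ i' j', i = i' + 1 ∧ j = j' + 1 ∧ i' ≠ 0 ∧ IsBlockOfOnes t i' j' := by
  obtain ⟨hij, h1, h2, h3⟩ := h
  have hbit (k : ℕ) : (2 * t + 1).testBit (k + 1) = t.testBit k := by
    rw [Nat.testBit_add_one]; congr 1; omega
  obtain ⟨j, rfl⟩ : ∃ j', j = j' + 1 := ⟨j - 1, by omega⟩
  rcases i with _ | i
  · exact Or.inl ⟨rfl, fun k hk => h1 k (Nat.zero_le _) hk, h2⟩
  · refine Or.inr ⟨i, j, rfl, rfl, ?_, by omega, fun k hk hk' => ?_, ?_, fun k hk => ?_⟩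
    · rintro rfl
      have := h3 0 rfl
      simp at this
    · rw [← hbit]; exact h1 _ (by omega) (by omega)
    · rw [← hbit]; exact h2
    · rw [← hbit]; exact h3 _ (by omega)

theorem numBlocksOfOnes_two_mul_le (t : ℕ) : numBlocksOfOnes (2 * t) ≤ numBlocksOfOnes t := by
  refine (Set.ncard_le_ncard (t := (fun p : ℕ × ℕ => (p.1 + 1, p.2 + 1)) ''
    {p | IsBlockOfOnes t p.1 p.2}) ?_ ((finite_blocksOfOnes t).image _)).trans
    (Set.ncard_image_le (finite_blocksOfOnes t))
  rintro ⟨i, j⟩ (h : IsBlockOfOnes (2 * t) i j)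
  obtain ⟨i', j', hi, hj, h'⟩ := isBlockOfOnes_two_mul h
  exact ⟨(i', j'), h', by simp [hi, hj]⟩

theorem eq_of_initial_block {t j j' : ℕ} (h : ∀ k < j, t.testBit k = true)
    (h0 : t.testBit j = false) (h' : ∀ k < j', t.testBit k = true)
    (h0' : t.testBit j' = false) : j = j' := by
  rcases lt_trichotomy j j' with hlt | heq | hgt
  · simp [h' j hlt] at h0
  · exact heq
  · simp [h j' hgt] at h0'

theorem numBlocksOfOnes_two_mul_add_one_le (t : ℕ) :
    numBlocksOfOnes (2 * t + 1) ≤ numBlocksOfOnes t + 1 := by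
  by_cases hex : ∃ j, IsBlockOfOnes (2 * t + 1) 0 j
  · obtain ⟨j₀, hj₀⟩ := hex
    refine (Set.ncard_le_ncard (t := insert (0, j₀) ((fun p : ℕ × ℕ => (p.1 + 1, p.2 + 1)) ''
      {p | IsBlockOfOnes t p.1 p.2})) ?_ (((finite_blocksOfOnes t).image _).insert _)).trans
      ((Set.ncard_insert_le _ _).trans
        (Nat.add_le_add_right (Set.ncard_image_le (finite_blocksOfOnes t)) 1))
    rintro ⟨i, j⟩ (h : IsBlockOfOnes (2 * t + 1) i j)
    rcases isBlockOfOnes_two_mul_add_one h with ⟨rfl, h1, h2⟩ | ⟨i', j', hi, hj, -, h'⟩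
    · refine Or.inl ?_
      rw [eq_of_initial_block h1 h2 (fun k hk => hj₀.2.1 k (Nat.zero_le _) hk) hj₀.2.2.1]
    · exact Or.inr ⟨(i', j'), h', by simp [hi, hj]⟩
  · refine (Set.ncard_le_ncard (t := (fun p : ℕ × ℕ => (p.1 + 1, p.2 + 1)) ''
      {p | IsBlockOfOnes t p.1 p.2}) ?_ ((finite_blocksOfOnes t).image _)).trans
      ((Set.ncard_image_le (finite_blocksOfOnes t)).trans (Nat.le_succ _))
    rintro ⟨i, j⟩ (h : IsBlockOfOnes (2 * t + 1) i j)
    rcases isBlockOfOnes_two_mul_add_one h with ⟨rfl, h1, h2⟩ | ⟨i', j', hi, hj, -, h'⟩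
    · exact absurd ⟨j, h⟩ hex
    · exact ⟨(i', j'), h', by simp [hi, hj]⟩

theorem numBlocksOfOnes_two_mul_add_one_le_of_odd {t : ℕ} (ht : t % 2 = 1) :
    numBlocksOfOnes (2 * t + 1) ≤ numBlocksOfOnes t := by
  -- A 1 appended below a 1 lengthens the lowest block, whose start stays at 0; all other blocks
  -- shift.
  refine (Set.ncard_le_ncard (t := (fun p : ℕ × ℕ => (if p.1 = 0 then 0 else p.1 + 1, p.2 + 1)) ''
    {p | IsBlockOfOnes t p.1 p.2}) ?_ ((finite_blocksOfOnes t).image _)).trans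
    (Set.ncard_image_le (finite_blocksOfOnes t))
  have hbit (k : ℕ) : (2 * t + 1).testBit (k + 1) = t.testBit k := by
    rw [Nat.testBit_add_one]; congr 1; omega
  rintro ⟨i, j⟩ (h : IsBlockOfOnes (2 * t + 1) i j)
  rcases isBlockOfOnes_two_mul_add_one h with ⟨rfl, h1, h2⟩ | ⟨i', j', hi, hj, hi', h'⟩
  · obtain ⟨j, rfl⟩ : ∃ j', j = j' + 1 := ⟨j - 1, by have : 0 < j := h.1; omega⟩
    rw [hbit] at h2
    refine ⟨(0, j), ⟨?_, fun k _ hk => ?_, h2, fun k hk => by simp at hk⟩, by simp⟩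
    · refine Nat.pos_of_ne_zero ?_
      rintro rfl
      simp [ht] at h2
    · rw [← hbit]; exact h1 _ (by omega)
  · exact ⟨(i', j'), h', by simp [hi, hj, hi']⟩

theorem numBlocksOfOnes_zero : numBlocksOfOnes 0 = 0 := by
  rw [numBlocksOfOnes, Set.ncard_eq_zero (finite_blocksOfOnes 0)]
  ext ⟨i, j⟩
  simp only [Set.mem_ofPred_eq, Set.mem_empty_iff_false, iff_false]
  intro h
  have := h.2.1 i le_rfl h.1
  simp at this

/-- The odd rule involves both v(t) and v(t + 1), so their sum is the quantity to follow. By the gap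
bound it does not decrease when 0 is appended, or 1 after a 1, and it grows by at least 2 when 01 is
appended. A block is born only in the last case. -/
theorem numBlocksOfOnes_le_diffVariance_add (t : ℕ) :
    (numBlocksOfOnes t : ℝ) ≤ diffVariance t + diffVariance (t + 1) := by
  induction t using Nat.strong_induction_on with
  | _ t ih =>
    obtain ⟨k, rfl | rfl⟩ := Nat.even_or_odd' t
    · rcases Nat.eq_zero_or_pos k with rfl | hk
      · simp [numBlocksOfOnes_zero, diffVariance_zero, diffVariance_one]
      · have h1 := ih k (by omega)
        have h2 : (numBlocksOfOnes (2 * k) : ℝ) ≤ numBlocksOfOnes k := by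
          exact_mod_cast numBlocksOfOnes_two_mul_le k
        have h3 := abs_le.1 (abs_diffVariance_succ_sub_le k)
        rw [diffVariance_two_mul, diffVariance_two_mul_add_one]
        linarith
    · have hsucc : 2 * k + 1 + 1 = 2 * (k + 1) := by ring
      obtain ⟨m, rfl | rfl⟩ := Nat.even_or_odd' k
      · have h1 := ih m (by omega)
        have h2 : (numBlocksOfOnes (2 * (2 * m) + 1) : ℝ) ≤ numBlocksOfOnes m + 1 := by
          exact_mod_cast (numBlocksOfOnes_two_mul_add_one_le (2 * m)).trans
            (Nat.add_le_add_right (numBlocksOfOnes_two_mul_le m) 1)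
        have h3 := abs_le.1 (abs_diffVariance_succ_sub_le m)
        rw [hsucc, diffVariance_two_mul, diffVariance_two_mul_add_one (2 * m),
          diffVariance_two_mul_add_one m, diffVariance_two_mul]
        linarith
      · have h1 := ih (2 * m + 1) (by omega)
        have h2 : (numBlocksOfOnes (2 * (2 * m + 1) + 1) : ℝ) ≤ numBlocksOfOnes (2 * m + 1) := by
          exact_mod_cast numBlocksOfOnes_two_mul_add_one_le_of_odd (by omega)
        have h3 := abs_le.1 (abs_diffVariance_succ_sub_le (2 * m + 1))
        rw [hsucc, diffVariance_two_mul, diffVariance_two_mul_add_one (2 * m + 1)]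
        linarith

theorem numBlocksOfOnes_le_two_mul_diffVariance (t : ℕ) :
    (numBlocksOfOnes t : ℝ) ≤ 2 * diffVariance t + 2 := by
  have h1 := numBlocksOfOnes_le_diffVariance_add t
  have h2 := abs_le.1 (abs_diffVariance_succ_sub_le t)
  linarith

/-! ### Counting integers with few blocks -/

/-- A digit `1` lies in a block of `1`s. -/
theorem exists_isBlockOfOnes {t k : ℕ} (h : t.testBit k = true) :
    ∃ i j, i ≤ k ∧ k < j ∧ IsBlockOfOnes t i j := by
  classical
  have hup : ∃ j, k < j ∧ t.testBit j = false := by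
    refine ⟨t + k + 1, by omega, Nat.testBit_lt_two_pow ?_⟩
    exact lt_of_lt_of_le Nat.lt_two_pow_self (Nat.pow_le_pow_right two_pos (by omega))
  have hdown : ∃ i, i ≤ k ∧ ∀ l, i ≤ l → l ≤ k → t.testBit l = true :=
    ⟨k, le_rfl, fun l h1 h2 => by rwa [le_antisymm h2 h1]⟩
  obtain ⟨hj1, hj2⟩ := Nat.find_spec hup
  obtain ⟨hi1, hi2⟩ := Nat.find_spec hdown
  refine ⟨Nat.find hdown, Nat.find hup, hi1, hj1, lt_of_le_of_lt hi1 hj1, fun l h1 h2 => ?_, hj2,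
    fun l hl => ?_⟩
  · rcases le_or_gt l k with hlk | hlk
    · exact hi2 l h1 hlk
    · have := Nat.find_min hup h2
      simpa [hlk] using this
  · by_contra hne
    refine Nat.find_min hdown (m := l) (by omega) ⟨by omega, fun m h1 h2 => ?_⟩
    rcases h1.eq_or_lt with rfl | h1
    · simpa using hne
    · exact hi2 m (by omega) h2

theorem setOf_isBlockOfOnes_injective :
    Function.Injective fun t : ℕ => {p : ℕ × ℕ | IsBlockOfOnes t p.1 p.2} := by
  have key {s t : ℕ} (h : {p : ℕ × ℕ | IsBlockOfOnes s p.1 p.2} ⊆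
      {p | IsBlockOfOnes t p.1 p.2}) (k : ℕ) (hk : s.testBit k = true) : t.testBit k = true := by
    obtain ⟨i, j, h1, h2, hb⟩ := exists_isBlockOfOnes hk
    exact (h (a := (i, j)) hb).2.1 k h1 h2
  intro s t h
  refine Nat.eq_of_testBit_eq fun k => Bool.eq_iff_iff.2 ⟨key h.subset k, key h.superset k⟩

/-- An integer is determined by its blocks; here they form a set of fewer than L pairs from a square
of (m + 1)² points. -/
theorem ncard_numBlocksOfOnes_lt_le (m L : ℕ) :
    {t : ℕ | t < 2 ^ m ∧ numBlocksOfOnes t < L}.ncard ≤ L * (m + 1) ^ (2 * L) := by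
  classical
  set Q : Finset (ℕ × ℕ) := Finset.range (m + 1) ×ˢ Finset.range (m + 1)
  set F : Finset (Finset (ℕ × ℕ)) := (Finset.range L).biUnion fun l => Finset.powersetCard l Q
  have hF : F.card ≤ L * (m + 1) ^ (2 * L) := by
    refine (Finset.card_biUnion_le_card_mul (n := (m + 1) ^ (2 * L)) _ _ fun l hl => ?_).trans
      (by simp)
    rw [Finset.card_powersetCard]
    refine (Nat.choose_le_pow _ _).trans ?_
    rw [show Q.card = (m + 1) ^ 2 by simp [Q, sq], ← pow_mul]
    exact Nat.pow_le_pow_right (by omega) (by simp at hl; omega)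
  refine le_trans ?_ hF
  rw [← Set.ncard_coe_finset]
  refine Set.ncard_le_ncard_of_injOn (fun t => (finite_blocksOfOnes t).toFinset) ?_ ?_
    F.finite_toSet
  · rintro t ⟨h1, h2⟩
    simp only [F, Finset.coe_biUnion, Set.mem_iUnion, Finset.mem_coe, Finset.mem_range,
      Finset.mem_powersetCard, exists_prop]
    refine ⟨_, h2, ?_, ?_⟩
    · rintro ⟨i, j⟩ h
      rw [Set.Finite.mem_toFinset] at h
      have hb := h.2.1 (j - 1) (Nat.le_sub_one_of_lt h.1) (by have : i < j := h.1; omega)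
      have hj : j - 1 < m := by
        by_contra hge
        have := Nat.ge_two_pow_of_testBit hb
        have := Nat.pow_le_pow_right two_pos (not_lt.1 hge)
        omega
      have : i < j := h.1
      simp only [Q, Finset.mem_product, Finset.mem_range]
      omega
    · rw [numBlocksOfOnes, Set.ncard_eq_toFinset_card _ (finite_blocksOfOnes t)]
  · intro s _ t _ h
    exact setOf_isBlockOfOnes_injective (Set.Finite.toFinset_inj.1 h)

/-! ### The normal limit law -/

/-- The law of `digitSumDiff t n / r` for `n` uniformly distributed on `{0, …, 2 ^ M - 1}`. -/
noncomputable def diffLaw (M t : ℕ) (r : ℝ) : MeasureTheory.Measure ℝ :=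
  ((2 : ENNReal) ^ M)⁻¹ •
    ∑ n ∈ Finset.range (2 ^ M), MeasureTheory.Measure.dirac ((digitSumDiff t n : ℝ) / r)

instance isProbabilityMeasure_diffLaw (M t : ℕ) (r : ℝ) :
    MeasureTheory.IsProbabilityMeasure (diffLaw M t r) := by
  refine ⟨?_⟩
  simp only [diffLaw, MeasureTheory.Measure.smul_apply, MeasureTheory.Measure.finsetSum_apply,
    MeasureTheory.measure_univ, Finset.sum_const, Finset.card_range, nsmul_eq_mul, mul_one,
    smul_eq_mul]
  push_cast
  exact ENNReal.inv_mul_cancel (by simp) (by finiteness)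

theorem charFun_diffLaw (M t : ℕ) (r θ : ℝ) :
    MeasureTheory.charFun (diffLaw M t r) θ = diffCharFun M t (θ / r) := by
  rw [MeasureTheory.charFun_apply_real, diffLaw, MeasureTheory.integral_smul_measure,
    MeasureTheory.integral_finsetSum_measure fun n _ => MeasureTheory.integrable_dirac (by simp)]
  simp only [MeasureTheory.integral_dirac, diffCharFun]
  rw [div_eq_inv_mul, ENNReal.toReal_inv, ENNReal.toReal_pow, Complex.real_smul]
  congr 1
  · simp
  · refine Finset.sum_congr rfl fun n _ => ?_
    push_cast
    congr 1; ring

/-- Dropping the ties d = 0 leaves an open half-line, for which weak convergence gives the lower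
bound needed. -/
theorem diffLaw_Ioi_le (M t : ℕ) {r : ℝ} (hr : 0 < r) :
    (diffLaw M t r (Set.Ioi 0)).toReal ≤
      1 / (2 ^ M : ℕ) * ({n | n < 2 ^ M ∧ n ∈ cusickSet t}.ncard : ℝ) := by
  classical
  have hset : {n | n < 2 ^ M ∧ n ∈ cusickSet t} =
      ((Finset.range (2 ^ M)).filter fun n => 0 ≤ digitSumDiff t n : Finset ℕ) := by
    ext n
    simp [mem_cusickSet_iff]
  rw [hset, Set.ncard_coe_finset, Finset.card_filter, diffLaw,
    MeasureTheory.Measure.smul_apply, MeasureTheory.Measure.finsetSum_apply, smul_eq_mul,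
    ENNReal.toReal_mul, ENNReal.toReal_inv, ENNReal.toReal_pow,
    ENNReal.toReal_sum fun n _ => by finiteness]
  push_cast
  rw [one_div, ENNReal.toReal_ofNat]
  gcongr with n hn
  rw [MeasureTheory.Measure.dirac_apply' _ measurableSet_Ioi]
  by_cases h : 0 ≤ digitSumDiff t n
  · rw [if_pos h]
    by_cases h' : (digitSumDiff t n : ℝ) / r ∈ Set.Ioi (0 : ℝ)
    · simp [Set.indicator_of_mem h']
    · simp [Set.indicator_of_notMem h']
  · have h' : (digitSumDiff t n : ℝ) / r ∉ Set.Ioi (0 : ℝ) := by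
      have : (digitSumDiff t n : ℝ) < 0 := by exact_mod_cast not_le.1 h
      simpa using (div_neg_of_neg_of_pos this hr).le
    simp [Set.indicator_of_notMem h', if_neg h]

theorem gaussianReal_Ioi_zero :
    ProbabilityTheory.gaussianReal 0 1 (Set.Ioi 0) = 2⁻¹ := by
  set μ := ProbabilityTheory.gaussianReal 0 1 with hμ
  have := ProbabilityTheory.nullSingletonClass_gaussianReal (μ := 0) (v := 1) one_ne_zero
  have h1 : μ (Set.Iio 0) = μ (Set.Ioi 0) := by
    have h : μ.map (fun x => -x) = μ := by
      rw [hμ, ProbabilityTheory.gaussianReal_map_neg, neg_zero]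
    conv_rhs => rw [← h]
    rw [MeasureTheory.Measure.map_apply measurable_neg measurableSet_Ioi]
    congr 1
    ext x
    simp
  have h2 : μ (Set.Ioi 0) + μ (Set.Iic 0) = 1 := by
    rw [← Set.compl_Ioi, MeasureTheory.measure_add_measure_compl measurableSet_Ioi,
      MeasureTheory.measure_univ]
  rw [← MeasureTheory.Iio_ae_eq_Iic.measure_eq, h1, ← two_mul] at h2
  exact ENNReal.eq_inv_of_mul_eq_one_left (by rwa [mul_comm])

/-- Normal limit law for `digitSumDiff` along sequences of growing variance. -/
theorem tendsto_charFun_diffLaw {t M : ℕ → ℕ}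
    (hv : Tendsto (fun L => diffVariance (t L)) atTop atTop)
    (hM : Tendsto (fun L => (t L : ℝ) / 2 ^ M L) atTop (𝓝 0)) (θ : ℝ) :
    Tendsto (fun L => MeasureTheory.charFun (diffLaw (M L) (t L) √(diffVariance (t L))) θ) atTop
      (𝓝 (Complex.exp (-(θ : ℂ) ^ 2 / 2))) := by
  have hs : Tendsto (fun L => √(diffVariance (t L))) atTop atTop :=
    Real.tendsto_sqrt_atTop.comp hv
  rw [tendsto_iff_norm_sub_tendsto_zero]
  refine squeeze_zero' (g := fun L => |θ| ^ 3 / √(diffVariance (t L)) + 2 * (t L / 2 ^ M L))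
    (Eventually.of_forall fun _ => norm_nonneg _) ?_ ?_
  · filter_upwards [hs.eventually_ge_atTop (2 * |θ|), hs.eventually_gt_atTop 0] with L h1 h2
    have hsq : √(diffVariance (t L)) ^ 2 = diffVariance (t L) :=
      Real.sq_sqrt (diffVariance_nonneg _)
    have hsmall : |θ / √(diffVariance (t L))| ≤ 1 / 2 := by
      rw [abs_div, abs_of_pos h2, div_le_iff₀ h2]
      linarith
    have h := norm_diffCharFun_sub_exp_le hsmall (M L) (t L)
    rw [charFun_diffLaw]
    have hexp : (-(diffVariance (t L)) * ((θ / √(diffVariance (t L)) : ℝ) : ℂ) ^ 2 / 2 : ℂ) =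
        -(θ : ℂ) ^ 2 / 2 := by
      have hc : ((√(diffVariance (t L)) : ℝ) : ℂ) ^ 2 = diffVariance (t L) := by
        rw [← Complex.ofReal_pow, hsq]
      have hne : ((√(diffVariance (t L)) : ℝ) : ℂ) ≠ 0 := by exact_mod_cast h2.ne'
      rw [← hc]
      push_cast
      field_simp
    have hmul : |θ / √(diffVariance (t L))| ^ 3 * diffVariance (t L) =
        |θ| ^ 3 / √(diffVariance (t L)) := by
      rw [abs_div, abs_of_pos h2]
      nth_rw 2 [← hsq]
      field_simp
    rwa [hexp, hmul, mul_div_assoc] at h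
  · simpa using (tendsto_const_nhds.div_atTop hs).add (hM.const_mul 2)

/-! ### The lower bound and the exceptional set -/

theorem exists_forall_cusickDensity_gt {ε : ℝ} (hε : 0 < ε) :
    ∃ L : ℕ, ∀ t : ℕ, L ≤ numBlocksOfOnes t → cusickDensity t > 1 / 2 - ε := by
  by_contra! hcon
  choose t ht hc using hcon
  -- A single M must make the truncation error small and bring the frequency below 2 ^ M close to
  -- the density; half of ε pays for the latter.
  have hM (L : ℕ) : ∃ M : ℕ, (t L : ℝ) / 2 ^ M ≤ 1 / ((L : ℝ) + 1) ∧
      1 / ((2 ^ M : ℕ) : ℝ) * ({n | n < 2 ^ M ∧ n ∈ cusickSet (t L)}.ncard : ℝ)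
        ≤ 1 / 2 - ε / 2 := by
    have h1 : Tendsto (fun M : ℕ => (t L : ℝ) / 2 ^ M) atTop (𝓝 0) :=
      tendsto_const_nhds.div_atTop (tendsto_pow_atTop_atTop_of_one_lt one_lt_two)
    have h2 := (hasAsymptoticDensity_cusickSet (t L)).comp
      (tendsto_pow_atTop_atTop_of_one_lt (one_lt_two : 1 < 2))
    have h3 : (0 : ℝ) < 1 / ((L : ℝ) + 1) := by positivity
    exact ((h1.eventually_le_const h3).and
      (h2.eventually_le_const (lt_of_le_of_lt (hc L) (by linarith)))).exists
  choose M hM1 hM2 using hM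
  have hv : Tendsto (fun L => diffVariance (t L)) atTop atTop := by
    refine tendsto_atTop_mono (f := fun L : ℕ => ((L : ℝ) - 2) / 2) (fun L => ?_) ?_
    · have h1 := numBlocksOfOnes_le_two_mul_diffVariance (t L)
      have h2 : (L : ℝ) ≤ numBlocksOfOnes (t L) := by exact_mod_cast ht L
      linarith
    · exact (tendsto_atTop_add_const_right _ (-2) tendsto_natCast_atTop_atTop).atTop_div_const
        two_pos
  have hM0 : Tendsto (fun L => (t L : ℝ) / 2 ^ M L) atTop (𝓝 0) :=
    squeeze_zero (fun L => by positivity) hM1 tendsto_one_div_add_atTop_nhds_zero_nat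
  let ν (L : ℕ) : MeasureTheory.ProbabilityMeasure ℝ :=
    ⟨diffLaw (M L) (t L) √(diffVariance (t L)), inferInstance⟩
  let γ : MeasureTheory.ProbabilityMeasure ℝ :=
    ⟨ProbabilityTheory.gaussianReal 0 1, inferInstance⟩
  have hlim : Tendsto ν atTop (𝓝 γ) := by
    refine MeasureTheory.ProbabilityMeasure.tendsto_of_tendsto_charFun fun θ => ?_
    have hγ : MeasureTheory.charFun (ProbabilityTheory.gaussianReal 0 1) θ =
        Complex.exp (-(θ : ℂ) ^ 2 / 2) := by
      rw [ProbabilityTheory.charFun_gaussianReal]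
      congr 1
      push_cast
      ring
    have h := tendsto_charFun_diffLaw hv hM0 θ
    rw [← hγ] at h
    exact h
  have hport := MeasureTheory.ProbabilityMeasure.le_liminf_measure_open_of_tendsto hlim
    (isOpen_Ioi (a := (0 : ℝ)))
  change ProbabilityTheory.gaussianReal 0 1 (Set.Ioi 0) ≤
    liminf (fun L => diffLaw (M L) (t L) √(diffVariance (t L)) (Set.Ioi 0)) atTop at hport
  rw [gaussianReal_Ioi_zero] at hport
  have hbound : ∀ᶠ L in atTop, diffLaw (M L) (t L) √(diffVariance (t L)) (Set.Ioi 0) ≤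
      ENNReal.ofReal (1 / 2 - ε / 2) := by
    filter_upwards [hv.eventually_gt_atTop 0] with L hL
    rw [← ENNReal.ofReal_toReal (MeasureTheory.measure_ne_top _ (Set.Ioi (0 : ℝ)))]
    exact ENNReal.ofReal_le_ofReal
      ((diffLaw_Ioi_le (M L) (t L) (Real.sqrt_pos.2 hL)).trans (hM2 L))
  have hle := hport.trans ((liminf_le_liminf hbound).trans_eq (liminf_const _))
  have hlt : ENNReal.ofReal (1 / 2 - ε / 2) < 2⁻¹ := by
    rw [show (2⁻¹ : ENNReal) = ENNReal.ofReal (1 / 2) by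
      rw [one_div, ENNReal.ofReal_inv_of_pos two_pos, ENNReal.ofReal_ofNat]]
    exact (ENNReal.ofReal_lt_ofReal_iff (by norm_num)).2 (by linarith)
  exact absurd hle (not_le.2 hlt)

theorem exists_ncard_numBlocksOfOnes_lt_le (L : ℕ) :
    ∃ δ C : ℝ, 0 < δ ∧ 0 < C ∧ ∀ T : ℝ, 2 ≤ T →
      ({t : ℕ | (t : ℝ) < T ∧ numBlocksOfOnes t < L}.ncard : ℝ) ≤ C * Real.log T ^ δ := by
  have hlog2 : 0 < Real.log 2 := Real.log_pos one_lt_two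
  -- With m the ceiling of log₂ T ≥ 1, m + 1 ≤ 3 log₂ T. The exponent 2L + 1 and the factor L + 1
  -- keep δ and C positive when L = 0.
  refine ⟨2 * L + 1, (L + 1) * (3 / Real.log 2) ^ (2 * L + 1), by positivity, by positivity,
    fun T hT => ?_⟩
  have hlogT : Real.log 2 ≤ Real.log T := Real.log_le_log two_pos hT
  set m := ⌈Real.log T / Real.log 2⌉₊ with hm
  have hx : 1 ≤ Real.log T / Real.log 2 := by rwa [le_div_iff₀ hlog2, one_mul]
  have hmle : (m : ℝ) + 1 ≤ 3 / Real.log 2 * Real.log T := by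
    have := Nat.ceil_lt_add_one (zero_le_one.trans hx)
    calc (m : ℝ) + 1 ≤ 3 * (Real.log T / Real.log 2) := by linarith
      _ = _ := by ring
  have hTm : T ≤ 2 ^ m := by
    rw [← Real.log_le_log_iff (by linarith) (by positivity), Real.log_pow, ← div_le_iff₀ hlog2]
    exact Nat.le_ceil _
  have hsub : {t : ℕ | (t : ℝ) < T ∧ numBlocksOfOnes t < L} ⊆
      {t | t < 2 ^ m ∧ numBlocksOfOnes t < L} := fun t ht =>
    ⟨by exact_mod_cast ht.1.trans_le hTm, ht.2⟩
  have hcard := (Set.ncard_le_ncard hsub ((Set.finite_Iio (2 ^ m)).subset fun t ht => ht.1)).trans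
    (ncard_numBlocksOfOnes_lt_le m L)
  rw [show (2 * L + 1 : ℝ) = ((2 * L + 1 : ℕ) : ℝ) by push_cast; rfl, Real.rpow_natCast, mul_assoc,
    ← mul_pow]
  calc ({t : ℕ | (t : ℝ) < T ∧ numBlocksOfOnes t < L}.ncard : ℝ)
      ≤ L * ((m : ℝ) + 1) ^ (2 * L) := by exact_mod_cast hcard
    _ ≤ (L + 1) * ((m : ℝ) + 1) ^ (2 * L + 1) := by
        gcongr
        · linarith
        · linarith [(Nat.cast_nonneg m : (0 : ℝ) ≤ m)]
        · omega
    _ ≤ _ := by gcongr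

theorem theorem1 :
    (∀ t : ℕ, HasAsymptoticDensity (cusickSet t) (cusickDensity t)) ∧
    (∀ ε : ℝ, 0 < ε → ∃ L : ℕ, ∀ t : ℕ, L ≤ numBlocksOfOnes t →
      cusickDensity t > 1 / 2 - ε) ∧
    (∀ ε : ℝ, 0 < ε → ∃ δ C : ℝ, 0 < δ ∧ 0 < C ∧ ∀ T : ℝ, 2 ≤ T →
      (({t : ℕ | (t : ℝ) < T ∧ cusickDensity t ≤ 1 / 2 - ε}.ncard : ℕ) : ℝ) ≤
        C * (Real.log T) ^ δ) := by
  refine ⟨hasAsymptoticDensity_cusickSet, fun ε hε => exists_forall_cusickDensity_gt hε,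
    fun ε hε => ?_⟩
  obtain ⟨L, hL⟩ := exists_forall_cusickDensity_gt hε
  obtain ⟨δ, C, hδ, hC, h⟩ := exists_ncard_numBlocksOfOnes_lt_le L
  refine ⟨δ, C, hδ, hC, fun T hT => le_trans ?_ (h T hT)⟩
  refine Nat.cast_le.2 (Set.ncard_le_ncard (fun t ht => ⟨ht.1, ?_⟩) ?_)
  · exact not_le.1 fun hle => absurd (hL t hle) (not_lt.2 ht.2)
  · exact (Set.finite_Iio ⌈T⌉₊).subset fun t ht => Nat.lt_ceil.2 ht.1
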